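/- For $n\ge 1$ let $f(n)$ be the least integer $k$ such that every bounded set $A\subset\mathbb R^n$ with at least two points can be partitioned into at most $k$ sets, each of diameter strictly smaller than the diameter of $A$ (Euclidean distance). Then $f(321)\ge 333$. Moreover $f(n)>n+1$ for every $n\ge 321$, so Borsuk's conjecture that $f(n)=n+1$ fails in every dimension $n\ge 321$. -/

import Mathlib

/-- The set `A` can be partitioned into at most `k` sets of smaller diameter.
Parts are allowed to be empty, which is what "at most `k`" means; for bounded `A` all the diameters
are finite, so that `Metric.diam` is the usual diameter. -/
def SplitsIntoSmaller {E : Type*} [PseudoMetricSpace E] (A : Set E) (k : ℕ) : Prop :=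
  ∃ P : Fin k → Set E,
    (∀ i j, i ≠ j → Disjoint (P i) (P j)) ∧
    (⋃ i, P i) = A ∧
    ∀ i, Metric.diam (P i) < Metric.diam A

/-- The Borsuk number `f(n)`: the least `k` such that every bounded set with at least two points in
Euclidean `n`-space can be partitioned into at most `k` sets of smaller diameter. (Sets with at most
one point have diameter `0`, so no set has a smaller diameter.)
If there were no such `k`, the value would be `0`, so a positive value is always a true minimum. -/
noncomputable def borsukNumber (n : ℕ) : ℕ :=
  sInf {k : ℕ | ∀ A : Set (EuclideanSpace ℝ (Fin n)),
    Bornology.IsBounded A → A.Nontrivial → SplitsIntoSmaller A k}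

/-!
The vertices of a strongly regular graph, projected to the eigenspace of its larger restricted
eigenvalue, form a spherical set with only two distances, the smaller one between adjacent vertices.
A part of smaller diameter is therefore a clique. For the `G₂(4)`-graph, with parameters
`(416, 100, 36, 20)`, the eigenvalue `20` has multiplicity `65` and all cliques have at most `5`
vertices, so that at least `84 > 416 / 5` parts are needed in dimension `65` (Bondarenko). The
radius of the sphere is small compared to the diameter, which leaves room for an apex at distance
equal to the diameter from all the points in one dimension more. The apex is a part by itself, so
each further dimension adds at least one to the number of parts, and `f(65 + d) ≥ 84 + d`.

The vertices of the `G₂(4)`-graph are taken to be the `416` orthogonal bases of the Hermitian plane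
over `𝔽₁₆`. When this plane is taken to be the field `𝔽₄₀₉₆`, the Frobenius map and multiplication
by suitable roots of unity act on the graph, and reduce the verification of its parameters to `6`
vertices.
-/

open Metric

theorem exists_forall_splitsIntoSmaller (E : Type*) [NormedAddCommGroup E] [NormedSpace ℝ E]
    [ProperSpace E] :
    ∃ k, ∀ A : Set E, Bornology.IsBounded A → A.Nontrivial → SplitsIntoSmaller A k := by
  obtain ⟨t, -, htfin, ht⟩ := finite_cover_balls_of_compact
    (isCompact_closedBall (0 : E) 1) (by norm_num : (0 : ℝ) < 1 / 3)
  have := htfin.fintype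
  let e := Fintype.equivFin t
  have hcover (x : E) (hx : x ∈ closedBall 0 1) : ∃ i, dist x (e.symm i) < 1 / 3 := by
    obtain ⟨y, hy, hxy⟩ := Set.mem_iUnion₂.1 (ht hx)
    exact ⟨e ⟨y, hy⟩, by simpa using hxy⟩
  refine ⟨Fintype.card t, fun A hA ⟨a, ha, b, hb, hab⟩ => ?_⟩
  set D := diam A
  have hpos : 0 < D := (dist_pos.2 hab).trans_le (dist_le_diam_of_mem hA ha hb)
  have hball (x : A) : D⁻¹ • ((x : E) - a) ∈ closedBall 0 1 := by
    rw [mem_closedBall_zero_iff, norm_smul, norm_inv, Real.norm_of_nonneg hpos.le,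
      ← dist_eq_norm, inv_mul_le_one₀ hpos]
    exact dist_le_diam_of_mem hA x.2 ha
  choose c hc using fun x : A => hcover _ (hball x)
  refine ⟨fun i => (↑) '' (c ⁻¹' {i}), fun i j hij => ?_, ?_, fun i => ?_⟩
  · rw [Set.disjoint_image_iff Subtype.val_injective]
    exact (Set.disjoint_singleton.2 hij).preimage c
  · rw [← Set.image_iUnion, ← Set.preimage_iUnion, Set.iUnion_of_singleton, Set.preimage_univ,
      Set.image_univ, Subtype.range_coe]
  · suffices diam ((↑) '' (c ⁻¹' {i}) : Set E) ≤ 2 / 3 * D by linarith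
    refine diam_le_of_forall_dist_le (by positivity) ?_
    rintro _ ⟨x, rfl, rfl⟩ _ ⟨y, hxy : c y = c x, rfl⟩
    have h := (dist_triangle_right _ _ _).trans_lt (add_lt_add (hc x) (hxy ▸ hc y))
    rw [dist_smul₀, dist_sub_right, norm_inv, Real.norm_of_nonneg hpos.le,
      inv_mul_lt_iff₀ hpos] at h
    linarith

theorem le_borsukNumber_of_forall {n k : ℕ} {A : Set (EuclideanSpace ℝ (Fin n))}
    (hA : Bornology.IsBounded A) (hA' : A.Nontrivial) (h : ∀ j, SplitsIntoSmaller A j → k ≤ j) :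
    k ≤ borsukNumber n :=
  h _ (Nat.sInf_mem (exists_forall_splitsIntoSmaller _) A hA hA')

theorem SplitsIntoSmaller.card_le_mul {E ι : Type*} [PseudoMetricSpace E] [Fintype ι] {f : ι → E}
    {k m : ℕ} (h : SplitsIntoSmaller (Set.range f) k)
    (hm : ∀ s : Finset ι, (∀ i ∈ s, ∀ j ∈ s, dist (f i) (f j) < diam (Set.range f)) → s.card ≤ m) :
    Fintype.card ι ≤ m * k := by
  classical
  obtain ⟨P, -, hU, hdiam⟩ := h
  have hmem (i : ι) : ∃ a, f i ∈ P a := by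
    rw [← Set.mem_iUnion, hU]
    exact Set.mem_range_self i
  choose a ha using hmem
  have hbdd (b : Fin k) : Bornology.IsBounded (P b) :=
    (Set.finite_range f).isBounded.subset (hU ▸ Set.subset_iUnion P b)
  have hfiber (b : Fin k) : (Finset.univ.filter fun i => a i = b).card ≤ m := by
    refine hm _ fun i hi j hj => (dist_le_diam_of_mem (hbdd b) ?_ ?_).trans_lt (hdiam b)
    · exact (Finset.mem_filter.1 hi).2 ▸ ha i
    · exact (Finset.mem_filter.1 hj).2 ▸ ha j
  simpa using Finset.card_le_mul_card_image_of_maps_to (t := Finset.univ)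
    (fun i _ => Finset.mem_univ (a i)) m fun b _ => hfiber b

section Apex

variable {E F : Type*} [PseudoMetricSpace E] [PseudoMetricSpace F] {f : E → F} {A : Set E} {p : F}

theorem diam_insert_image_of_isometry (hf : Isometry f) (hA : Bornology.IsBounded A)
    (hp : ∀ a ∈ A, dist p (f a) = diam A) : diam (insert p (f '' A)) = diam A := by
  have hfA : Bornology.IsBounded (f '' A) := hf.lipschitz.isBounded_image hA
  refine le_antisymm (diam_le_of_forall_dist_le diam_nonneg ?_) ?_
  · rintro _ (rfl | ⟨a, ha, rfl⟩) _ (rfl | ⟨b, hb, rfl⟩)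
    · simp [diam_nonneg]
    · exact (hp b hb).le
    · exact (dist_comm _ _).trans_le (hp a ha).le
    · exact (hf.dist_eq a b).trans_le (dist_le_diam_of_mem hA ha hb)
  · rw [← hf.diam_image]
    exact diam_mono (Set.subset_insert _ _) (hfA.insert p)

theorem SplitsIntoSmaller.exists_of_insert_apex {k : ℕ} (hf : Isometry f)
    (hA : Bornology.IsBounded A) (hp : ∀ a ∈ A, dist p (f a) = diam A)
    (h : SplitsIntoSmaller (insert p (f '' A)) k) :
    ∃ j, k = j + 1 ∧ SplitsIntoSmaller A j := by
  obtain ⟨P, hdisj, hU, hdiam⟩ := h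
  rw [diam_insert_image_of_isometry hf hA hp] at hdiam
  have hbdd (i : Fin k) : Bornology.IsBounded (P i) :=
    ((hf.lipschitz.isBounded_image hA).insert p).subset (hU ▸ Set.subset_iUnion P i)
  obtain ⟨i₀, hi₀⟩ := Set.mem_iUnion.1 (hU ▸ Set.mem_insert p _)
  have hsep {a : E} (ha : a ∈ A) : f a ∉ P i₀ := fun h =>
    (hp a ha ▸ dist_le_diam_of_mem (hbdd i₀) hi₀ h).not_gt (hdiam i₀)
  obtain ⟨j, rfl⟩ := Nat.exists_eq_succ_of_ne_zero i₀.pos.ne'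
  refine ⟨j, rfl, fun i => A ∩ f ⁻¹' P (i₀.succAbove i), fun i i' hi => ?_, ?_, fun i => ?_⟩
  · exact ((hdisj _ _ (i₀.succAbove_right_injective.ne hi)).preimage f).mono
      Set.inter_subset_right Set.inter_subset_right
  · rw [← Set.inter_iUnion, Set.inter_eq_left]
    intro a ha
    obtain ⟨i, hi⟩ := Set.mem_iUnion.1 (hU ▸ Set.mem_insert_of_mem p (Set.mem_image_of_mem f ha))
    obtain ⟨i', rfl⟩ := Fin.exists_succAbove_eq fun h : i = i₀ => hsep ha (h ▸ hi)
    exact Set.mem_iUnion.2 ⟨i', hi⟩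
  · rw [← hf.diam_image]
    refine (diam_mono ?_ (hbdd _)).trans_lt (hdiam (i₀.succAbove i))
    exact (Set.image_mono Set.inter_subset_right).trans (Set.image_preimage_subset _ _)

end Apex

section Pyramid

/-- `A` is a set on a sphere that needs at least `k` parts of smaller diameter, with a radius so
small that a point at distance `diam A` from all of `A` exists in one dimension more. Adding that
point gives a set of the same kind. -/
structure IsPyramidBase {E : Type*} [PseudoMetricSpace E] (A : Set E) (k : ℕ) : Prop where
  nontrivial : A.Nontrivial
  spherical : ∃ c r, A ⊆ sphere c r ∧ 2 * r ^ 2 ≤ diam A ^ 2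
  le_of_splitsIntoSmaller : ∀ j, SplitsIntoSmaller A j → k ≤ j

theorem IsPyramidBase.isBounded {E : Type*} [PseudoMetricSpace E] {A : Set E} {k : ℕ}
    (h : IsPyramidBase A k) : Bornology.IsBounded A :=
  let ⟨_, _, hA, _⟩ := h.spherical
  isBounded_sphere.subset hA

theorem IsPyramidBase.diam_pos {E : Type*} [MetricSpace E] {A : Set E} {k : ℕ}
    (h : IsPyramidBase A k) : 0 < diam A :=
  let ⟨_, ha, _, hb, hab⟩ := h.nontrivial
  (dist_pos.2 hab).trans_le (dist_le_diam_of_mem h.isBounded ha hb)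

theorem exists_linearIsometry_inner_eq_zero (n : ℕ) :
    ∃ (f : EuclideanSpace ℝ (Fin n) →ₗᵢ[ℝ] EuclideanSpace ℝ (Fin (n + 1)))
      (e : EuclideanSpace ℝ (Fin (n + 1))), ‖e‖ = 1 ∧ ∀ x, inner ℝ (f x) e = 0 := by
  let e : EuclideanSpace ℝ (Fin (n + 1)) := EuclideanSpace.single 0 1
  have he : ‖e‖ = 1 := by simp [e]
  have : Fact (Module.finrank ℝ (EuclideanSpace ℝ (Fin (n + 1))) = n + 1) := ⟨by simp⟩
  have he0 : e ≠ 0 := norm_ne_zero_iff.1 (he ▸ one_ne_zero)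
  let b := OrthonormalBasis.fromOrthogonalSpanSingleton (𝕜 := ℝ) n he0
  refine ⟨(ℝ ∙ e)ᗮ.subtypeₗᵢ.comp b.repr.symm.toLinearIsometry, e, he, fun x => ?_⟩
  exact Submodule.inner_left_of_mem_orthogonal (Submodule.mem_span_singleton_self e)
    (b.repr.symm x).2

variable {E F : Type*} [NormedAddCommGroup E] [InnerProductSpace ℝ E] [NormedAddCommGroup F]
  [InnerProductSpace ℝ F] {f : E →ₗᵢ[ℝ] F} {e : F}

theorem dist_add_smul_sq (he : ‖e‖ = 1) (hfe : ∀ x, inner ℝ (f x) e = 0) (x y : E) (s t : ℝ) :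
    dist (f x + s • e) (f y + t • e) ^ 2 = dist x y ^ 2 + (s - t) ^ 2 := by
  have hsplit : f x + s • e - (f y + t • e) = f (x - y) + (s - t) • e := by
    rw [map_sub]
    module
  have horth : inner ℝ (f (x - y)) ((s - t) • e) = 0 := by rw [inner_smul_right, hfe, mul_zero]
  rw [dist_eq_norm, hsplit, sq, norm_add_sq_eq_norm_sq_add_norm_sq_real horth, f.norm_map,
    norm_smul, he, dist_eq_norm, Real.norm_eq_abs, mul_one, ← sq, ← sq, sq_abs]

theorem IsPyramidBase.insert_apex {A : Set E} {k : ℕ} {c : E} {r : ℝ} (h : IsPyramidBase A k)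
    (hA : A ⊆ sphere c r) (hr : 2 * r ^ 2 ≤ diam A ^ 2) (he : ‖e‖ = 1)
    (hfe : ∀ x, inner ℝ (f x) e = 0) :
    IsPyramidBase (insert (f c + √(diam A ^ 2 - r ^ 2) • e) (f '' A)) (k + 1) := by
  set D := diam A
  set t := √(D ^ 2 - r ^ 2)
  have hD : 0 < D := h.diam_pos
  have hsum : D ^ 2 = t ^ 2 + r ^ 2 := by linarith [Real.sq_sqrt (by nlinarith : 0 ≤ D ^ 2 - r ^ 2)]
  have ht : 0 < t := Real.sqrt_pos.2 (by nlinarith)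
  have hapex : ∀ a ∈ A, dist (f c + t • e) (f a) = D := by
    intro a ha
    refine (sq_eq_sq₀ dist_nonneg hD.le).1 ?_
    have hd := dist_add_smul_sq he hfe c a t 0
    rw [zero_smul, add_zero, dist_comm c a, mem_sphere.1 (hA ha), sub_zero] at hd
    linarith
  have hdiam := diam_insert_image_of_isometry f.isometry h.isBounded hapex
  -- The new centre is the point of the axis equidistant from the apex and the image of `A`.
  refine ⟨(h.nontrivial.image f.injective).mono (Set.subset_insert _ _),
    ⟨f c + ((t ^ 2 - r ^ 2) / (2 * t)) • e, D ^ 2 / (2 * t), ?_, ?_⟩, fun j hj => ?_⟩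
  · rintro _ (rfl | ⟨a, ha, rfl⟩) <;> refine (sq_eq_sq₀ dist_nonneg (by positivity)).1 ?_
    · rw [dist_add_smul_sq he hfe, dist_self]
      rw [hsum]
      field_simp
      ring
    · have hd := dist_add_smul_sq he hfe a c 0 ((t ^ 2 - r ^ 2) / (2 * t))
      rw [zero_smul, add_zero, mem_sphere.1 (hA ha)] at hd
      rw [hd, hsum]
      field_simp
      ring
  · rw [hdiam, div_pow, ← mul_div_assoc, div_le_iff₀ (by positivity)]
    nlinarith [mul_nonneg (sq_nonneg D) (sub_nonneg.2 hr)]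
  · obtain ⟨i, rfl, hi⟩ := SplitsIntoSmaller.exists_of_insert_apex f.isometry h.isBounded hapex hj
    exact Nat.succ_le_succ (h.le_of_splitsIntoSmaller i hi)

theorem IsPyramidBase.le_borsukNumber {m k : ℕ} {A : Set (EuclideanSpace ℝ (Fin m))}
    (h : IsPyramidBase A k) (d : ℕ) : k + d ≤ borsukNumber (m + d) := by
  suffices ∃ B : Set (EuclideanSpace ℝ (Fin (m + d))), IsPyramidBase B (k + d) from
    let ⟨_, hB⟩ := this
    le_borsukNumber_of_forall hB.isBounded hB.nontrivial hB.le_of_splitsIntoSmaller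
  induction d with
  | zero => exact ⟨A, h⟩
  | succ d ih =>
    obtain ⟨B, hB⟩ := ih
    obtain ⟨c, r, hsub, hr⟩ := hB.spherical
    obtain ⟨f, e, he, hfe⟩ := exists_linearIsometry_inner_eq_zero (m + d)
    exact ⟨_, hB.insert_apex hsub hr he hfe⟩

end Pyramid

section GramMatrix

open Matrix

theorem exists_inner_eq_of_mul_self_eq_smul {ι : Type*} [Fintype ι] {M : Matrix ι ι ℝ} {s : ℝ}
    {r : ℕ} (hM : M.IsSymm) (hMM : M * M = s • M) (hs : 0 < s) (hr : M.trace = s * r) :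
    ∃ p : ι → EuclideanSpace ℝ (Fin r), ∀ i j, inner ℝ (p i) (p j) = M i j := by
  classical
  have hidem : IsIdempotentElem (toLin' (s⁻¹ • M)) := by
    rw [IsIdempotentElem, Module.End.mul_eq_comp, ← toLin'_mul, smul_mul_smul_comm, hMM, smul_smul,
      inv_mul_cancel_right₀ hs.ne']
  have hrank : Module.finrank ℝ (LinearMap.range (toLin' (s⁻¹ • M))) = r := by
    have h := (LinearMap.IsIdempotentElem.isProj_range _ hidem).trace
    rw [trace_toLin'_eq, trace_smul, hr, smul_eq_mul, inv_mul_cancel_left₀ hs.ne'] at h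
    exact_mod_cast h.symm
  let W := (LinearMap.range (toLin' (s⁻¹ • M))).map
    (WithLp.linearEquiv 2 ℝ (ι → ℝ)).symm.toLinearMap
  have hW : Module.finrank ℝ W = r := (LinearEquiv.finrank_map_eq _ _).trans hrank
  have hmem (i : ι) : WithLp.toLp 2 (fun k => M k i) ∈ W :=
    ⟨fun k => M k i, ⟨Pi.single i s, by ext k; simp [hs.ne']⟩, rfl⟩
  let b := (stdOrthonormalBasis ℝ W).reindex (finCongr hW)
  refine ⟨fun i => (√s)⁻¹ • b.repr ⟨_, hmem i⟩, fun i j => ?_⟩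
  rw [real_inner_smul_left, real_inner_smul_right, LinearIsometryEquiv.inner_map_map,
    Submodule.coe_inner, ← mul_assoc, ← mul_inv, Real.mul_self_sqrt hs.le,
    inv_mul_eq_iff_eq_mul₀ hs.ne', ← smul_eq_mul, ← Matrix.smul_apply, ← hMM, mul_apply,
    PiLp.inner_apply]
  refine Finset.sum_congr rfl fun k _ => ?_
  rw [RCLike.inner_apply, conj_trivial, mul_comm]
  exact congr_arg (· * M k j) (hM.apply i k)

variable {V : Type*} [Fintype V]

theorem of_one_mul_of_one : (of 1 : Matrix V V ℝ) * of 1 = (Fintype.card V : ℝ) • of 1 := by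
  ext v w
  simp [mul_apply]

variable {G : SimpleGraph V} [DecidableRel G.Adj] {n k ℓ μ : ℕ} {θ τ : ℝ}

theorem adjMatrix_mul_of_one (h : G.IsRegularOfDegree k) :
    G.adjMatrix ℝ * of 1 = (k : ℝ) • of 1 := by
  ext v w
  simp [SimpleGraph.adjMatrix_mul_apply, h.degree_eq]

theorem of_one_mul_adjMatrix (h : G.IsRegularOfDegree k) :
    of 1 * G.adjMatrix ℝ = (k : ℝ) • of 1 := by
  ext v w
  simp [SimpleGraph.mul_adjMatrix_apply, h.degree_eq]

/-- When `G` is strongly regular of degree `k` with restricted eigenvalues `θ ≠ τ`, this is `θ - τ`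
times the orthogonal projection onto the eigenspace of `θ`: it kills the constant vectors and the
eigenspace of `τ`. -/
noncomputable def eigenspaceGram [DecidableEq V] (G : SimpleGraph V) [DecidableRel G.Adj] (k : ℕ)
    (τ : ℝ) : Matrix V V ℝ :=
  G.adjMatrix ℝ - τ • 1 - ((k - τ) / Fintype.card V) • of 1

theorem eigenspaceGram_apply [DecidableEq V] (v w : V) :
    eigenspaceGram G k τ v w = (if G.Adj v w then 1 else 0) - (if v = w then τ else 0) -
      (k - τ) / Fintype.card V := by
  simp [eigenspaceGram, one_apply]

theorem eigenspaceGram_isSymm [DecidableEq V] : (eigenspaceGram G k τ).IsSymm := by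
  ext v w
  simp only [transpose_apply, eigenspaceGram_apply, G.adj_comm, eq_comm]

theorem eigenspaceGram_trace [DecidableEq V] [Nonempty V] :
    (eigenspaceGram G k τ).trace = -Fintype.card V * τ - (k - τ) := by
  simp only [trace, diag_apply, eigenspaceGram_apply, G.irrefl, if_true, if_false,
    Finset.sum_const, Finset.card_univ, nsmul_eq_mul]
  field_simp
  ring

theorem adjMatrix_mul_self [DecidableEq V] (hG : G.IsSRGWith n k ℓ μ)
    (hadd : θ + τ = ℓ - μ) (hmul : θ * τ = μ - k) :
    G.adjMatrix ℝ * G.adjMatrix ℝ = (θ + τ) • G.adjMatrix ℝ - (θ * τ) • 1 + (μ : ℝ) • of 1 := by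
  have hJ : (of 1 : Matrix V V ℝ) = 1 + G.adjMatrix ℝ + Gᶜ.adjMatrix ℝ := by
    rw [← G.compl_adjMatrix_eq_adjMatrix_compl ℝ,
      G.one_add_adjMatrix_add_compl_adjMatrix_eq_of_one (α := ℝ)]
  rw [← sq, hG.matrix_eq, hJ, hadd, hmul]
  module

theorem sub_mul_sub_eq_card_mul (hG : G.IsSRGWith n k ℓ μ) [Nonempty V] (hadd : θ + τ = ℓ - μ)
    (hmul : θ * τ = μ - k) : (k - θ) * (k - τ) = Fintype.card V * μ := by
  classical
  have h := congr_arg (· * (of 1 : Matrix V V ℝ)) (adjMatrix_mul_self hG hadd hmul)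
  simp only [add_mul, sub_mul, smul_mul, one_mul, mul_assoc, Matrix.mul_smul, of_one_mul_of_one,
    adjMatrix_mul_of_one hG.regular] at h
  obtain ⟨v⟩ := ‹Nonempty V›
  have hv := congr_fun₂ h v v
  simp only [Matrix.add_apply, Matrix.sub_apply, Matrix.smul_apply, of_apply, Pi.one_apply,
    smul_eq_mul, mul_one] at hv
  linear_combination hv

theorem eigenspaceGram_mul_self [DecidableEq V] [Nonempty V] (hG : G.IsSRGWith n k ℓ μ)
    (hadd : θ + τ = ℓ - μ) (hmul : θ * τ = μ - k) :
    eigenspaceGram G k τ * eigenspaceGram G k τ = (θ - τ) • eigenspaceGram G k τ := by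
  have hμ : (μ : ℝ) = (k - θ) * ((k - τ) / Fintype.card V) := by
    field_simp
    linarith [sub_mul_sub_eq_card_mul hG hadd hmul]
  have hc : (Fintype.card V : ℝ) * ((k - τ) / Fintype.card V) = k - τ := by field_simp
  simp only [eigenspaceGram, mul_sub, sub_mul, smul_mul, Matrix.mul_smul, one_mul, mul_one,
    adjMatrix_mul_self hG hadd hmul, adjMatrix_mul_of_one hG.regular,
    of_one_mul_adjMatrix hG.regular, of_one_mul_of_one, hμ, smul_smul]
  generalize (k - τ) / (Fintype.card V : ℝ) = c at *
  match_scalars <;> first | ring1 | linear_combination c * hc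

theorem exists_dist_sq_eq_of_isSRGWith [Nonempty V] {r : ℕ} (hG : G.IsSRGWith n k ℓ μ)
    (hadd : θ + τ = ℓ - μ) (hmul : θ * τ = μ - k) (hθ : τ < θ)
    (hr : -n * τ - (k - τ) = (θ - τ) * r) :
    ∃ p : V → EuclideanSpace ℝ (Fin r), (∀ v, ‖p v‖ ^ 2 = -τ - (k - τ) / n) ∧
      ∀ v w, v ≠ w → dist (p v) (p w) ^ 2 = -2 * τ - if G.Adj v w then 2 else 0 := by
  classical
  obtain ⟨p, hp⟩ := exists_inner_eq_of_mul_self_eq_smul eigenspaceGram_isSymm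
    (eigenspaceGram_mul_self hG hadd hmul) (sub_pos.2 hθ)
    (eigenspaceGram_trace.trans (by rw [hG.card, hr]))
  have hnorm (v : V) : ‖p v‖ ^ 2 = -τ - (k - τ) / n := by
    rw [← real_inner_self_eq_norm_sq, hp, eigenspaceGram_apply, hG.card, if_neg (G.irrefl),
      if_pos rfl, zero_sub]
  refine ⟨p, hnorm, fun v w hvw => ?_⟩
  rw [dist_eq_norm, norm_sub_sq_real, hnorm, hnorm, hp, eigenspaceGram_apply, hG.card, if_neg hvw]
  split_ifs <;> ring

theorem exists_isPyramidBase_of_isSRGWith {r m q : ℕ} (hG : G.IsSRGWith n k ℓ μ)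
    (hadd : θ + τ = ℓ - μ) (hmul : θ * τ = μ - k) (hθ : τ < θ) (hτ : τ < 0)
    (hr : -n * τ - (k - τ) = (θ - τ) * r) (hne : G ≠ ⊤) (hclique : G.CliqueFree (m + 1))
    (hq : ∀ j, n ≤ m * j → q ≤ j) :
    ∃ A : Set (EuclideanSpace ℝ (Fin r)), IsPyramidBase A q := by
  obtain ⟨v, w, hvw, hadj⟩ := SimpleGraph.ne_top_iff_exists_not_adj.1 hne
  have : Nonempty V := ⟨v⟩
  obtain ⟨p, hnorm, hdist⟩ := exists_dist_sq_eq_of_isSRGWith hG hadd hmul hθ hr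
  have hdist_le (v w : V) : dist (p v) (p w) ≤ √(-2 * τ) := by
    obtain rfl | h := eq_or_ne v w
    · simp
    · refine Real.le_sqrt_of_sq_le ?_
      rw [hdist v w h]
      split_ifs <;> linarith
  have hdist_eq {v w : V} (h : v ≠ w) (hadj : ¬G.Adj v w) : dist (p v) (p w) = √(-2 * τ) := by
    rw [eq_comm, Real.sqrt_eq_iff_eq_sq (by linarith) dist_nonneg, hdist v w h, if_neg hadj,
      sub_zero]
  have hdiam : diam (Set.range p) = √(-2 * τ) := by
    refine le_antisymm (diam_le_of_forall_dist_le (by positivity) ?_) ?_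
    · rintro _ ⟨v, rfl⟩ _ ⟨w, rfl⟩
      exact hdist_le v w
    · rw [← hdist_eq hvw hadj]
      exact dist_le_diam_of_mem (Set.finite_range p).isBounded ⟨v, rfl⟩ ⟨w, rfl⟩
  refine ⟨Set.range p, ⟨p v, ⟨v, rfl⟩, p w, ⟨w, rfl⟩, fun h => ?_⟩, ⟨0, ‖p v‖, ?_, ?_⟩, ?_⟩
  · have h0 := hdist_eq hvw hadj
    rw [h, dist_self, eq_comm, Real.sqrt_eq_zero'] at h0
    linarith
  · rintro _ ⟨u, rfl⟩
    rw [mem_sphere_zero_iff_norm, ← sq_eq_sq₀ (norm_nonneg _) (norm_nonneg _), hnorm, hnorm]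
  · rw [hdiam, hnorm, Real.sq_sqrt (by linarith)]
    have : 0 ≤ ((k : ℝ) - τ) / n := div_nonneg (by linarith [k.cast_nonneg (α := ℝ)]) n.cast_nonneg
    linarith
  · refine fun j hj => hq j (hG.card ▸ hj.card_le_mul fun s hs => ?_)
    by_contra! hcard
    obtain ⟨t, hts, htcard⟩ := Finset.exists_subset_card_eq hcard
    refine hclique t ⟨fun v hv w hw hvw => ?_, htcard⟩
    by_contra hadj
    exact (hs v (hts hv) w (hts hw)).ne ((hdist_eq hvw hadj).trans hdiam.symm)

end GramMatrix

section StronglyRegular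

open Finset

variable {V : Type*} {G : SimpleGraph V} {R : Set V}

theorem cliqueFree_succ_of_representatives {m : ℕ} (hR : ∀ v, ∃ φ : G ≃g G, φ v ∈ R)
    (h : ∀ v ∈ R, ∀ s, G.IsNClique m s → ∃ u ∈ s, ¬G.Adj v u) : G.CliqueFree (m + 1) := by
  classical
  intro s hs
  obtain ⟨v, hv⟩ : s.Nonempty := card_pos.1 (by rw [hs.card_eq]; omega)
  obtain ⟨φ, hφ⟩ := hR v
  have hclique : G.IsNClique m ((s.erase v).map φ.toEquiv.toEmbedding) := by
    refine ⟨?_, by rw [card_map, card_erase_of_mem hv, hs.card_eq, Nat.add_sub_cancel]⟩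
    rw [coe_map]
    rintro _ ⟨u, hu, rfl⟩ _ ⟨w, hw, rfl⟩ huw
    exact φ.map_adj_iff.2 (hs.isClique (mem_of_mem_erase hu) (mem_of_mem_erase hw)
      (mt (congr_arg _) huw))
  obtain ⟨_, hmem, hadj⟩ := h _ hφ _ hclique
  obtain ⟨u, hu, rfl⟩ := mem_map.1 hmem
  exact hadj (φ.map_adj_iff.2 (hs.isClique hv (mem_of_mem_erase hu) (ne_of_mem_erase hu).symm))

variable [Fintype V] [DecidableEq V] [DecidableRel G.Adj] {k ℓ μ : ℕ}

theorem isSRGWith_of_card_filter_adj (h : ∀ v w, #{u | G.Adj v u ∧ G.Adj w u} =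
    if v = w then k else if G.Adj v w then ℓ else μ) :
    G.IsSRGWith (Fintype.card V) k ℓ μ := by
  have hcommon (v w : V) :
      Fintype.card (G.commonNeighbors v w) = #{u | G.Adj v u ∧ G.Adj w u} := by
    rw [← Set.toFinset_card]
    congr 1
    ext u
    simp [SimpleGraph.mem_commonNeighbors]
  refine ⟨rfl, fun v => ?_, fun v w hvw => ?_, fun v w hne hvw => ?_⟩
  · have hv := h v v
    simp only [and_self, if_true] at hv
    rw [← hv, ← G.card_neighborFinset_eq_degree, G.neighborFinset_eq_filter]
  · rw [hcommon, h, if_neg hvw.ne, if_pos hvw]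
  · rw [hcommon, h, if_neg hne, if_neg hvw]

theorem isSRGWith_of_representatives (hR : ∀ v, ∃ φ : G ≃g G, φ v ∈ R)
    (h : ∀ v ∈ R, ∀ w, #{u | G.Adj v u ∧ G.Adj w u} =
      if v = w then k else if G.Adj v w then ℓ else μ) :
    G.IsSRGWith (Fintype.card V) k ℓ μ := by
  refine isSRGWith_of_card_filter_adj fun v w => ?_
  obtain ⟨φ, hφ⟩ := hR v
  have h' := h _ hφ (φ w)
  simp only [φ.injective.eq_iff, φ.map_adj_iff] at h'
  rw [← h']
  refine card_bijective φ φ.bijective fun u => ?_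
  simp only [mem_filter_univ, φ.map_adj_iff]

end StronglyRegular

section CliqueLists

variable {α : Type*}

/-- `List.filter`, written with the bare recursor, which the kernel evaluates much faster. -/
noncomputable def filterRec (p : α → Bool) (l : List α) : List α :=
  List.rec [] (fun a _ ih => Bool.rec ih (a :: ih) (p a)) l

/-- The sublists of length `d` of a list whose entries are pairwise related by the Boolean relation
`r`, in other words its `d`-cliques. Bare recursors are used as in `filterRec`. -/
noncomputable def cliqueLists (r : α → α → Bool) (d : ℕ) : List α → List (List α) :=
  Nat.rec (fun _ => [[]]) (fun _ ih l => List.rec [] (fun x l rest =>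
    List.rec rest (fun s _ acc => (x :: s) :: acc) (ih (filterRec (r x) l))) l) d

theorem filterRec_eq_filter (p : α → Bool) (l : List α) : filterRec p l = l.filter p := by
  induction l with
  | nil => rfl
  | cons a l ih =>
    have hrec (b : Bool) (L : List α) : (Bool.rec L (a :: L) b : List α) =
        bif b then a :: L else L := by cases b <;> rfl
    have hcons : filterRec p (a :: l) = bif p a then a :: filterRec p l else filterRec p l :=
      hrec _ _
    rw [hcons, ih, List.filter_cons, Bool.cond_eq_ite]

theorem cliqueLists_succ_cons (r : α → α → Bool) (d : ℕ) (x : α) (l : List α) :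
    cliqueLists r (d + 1) (x :: l) =
      (cliqueLists r d (l.filter (r x))).map (x :: ·) ++ cliqueLists r (d + 1) l := by
  have hrec (L M : List (List α)) :
      (List.rec M (fun s _ acc => (x :: s) :: acc) L : List (List α)) = L.map (x :: ·) ++ M := by
    induction L with
    | nil => rfl
    | cons s L ih => exact congr_arg _ ih
  rw [← filterRec_eq_filter]
  exact hrec _ _

theorem mem_cliqueLists {r : α → α → Bool} {d : ℕ} {l s : List α} :
    s ∈ cliqueLists r d l ↔ s.Sublist l ∧ s.length = d ∧ s.Pairwise (r · ·) := by
  induction d generalizing l s with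
  | zero =>
    change s ∈ [[]] ↔ _
    rw [List.mem_singleton, List.length_eq_zero_iff]
    exact ⟨by rintro rfl; simp, fun h => h.2.1⟩
  | succ d ihd =>
    induction l generalizing s with
    | nil =>
      refine iff_of_false List.not_mem_nil fun h => ?_
      simp [List.sublist_nil.1 h.1] at h
    | cons x l ihl =>
      rw [cliqueLists_succ_cons, List.mem_append, ihl, List.mem_map, List.sublist_cons_iff,
        or_and_right, or_comm]
      refine or_congr_right ⟨?_, ?_⟩
      · rintro ⟨t, ht, rfl⟩
        obtain ⟨hsub, hlen, hpair⟩ := ihd.1 ht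
        exact ⟨⟨t, rfl, hsub.trans List.filter_sublist⟩, congr_arg _ hlen,
          List.pairwise_cons.2 ⟨fun z hz => List.of_mem_filter (hsub.subset hz), hpair⟩⟩
      · rintro ⟨⟨t, rfl, hsub⟩, hlen, hpair⟩
        rw [List.pairwise_cons] at hpair
        refine ⟨t, ihd.2 ⟨?_, Nat.succ_injective hlen, hpair.2⟩, rfl⟩
        rw [← List.filter_eq_self.2 hpair.1]
        exact hsub.filter _

theorem nodup_of_cliqueLists_beq_eq_nil {l : List ℕ} (h : cliqueLists Nat.beq 2 l = []) :
    l.Nodup := by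
  refine List.nodup_iff_sublist.2 fun a ha => ?_
  have := mem_cliqueLists (r := Nat.beq) (d := 2) (s := [a, a]) |>.2 ⟨ha, rfl, by simp⟩
  simp [h] at this

end CliqueLists

section CodedGraphs

open Finset

variable {V : Type*} {c : V → ℕ} {L : List ℕ}

theorem card_filter_eq_length_filterRec [Fintype V] (hc : c.Injective) (hL : L.Nodup)
    (hmem : ∀ a, a ∈ L ↔ ∃ v, c v = a) (p : ℕ → Bool) :
    #{v | p (c v)} = (filterRec p L).length := by
  rw [filterRec_eq_filter, ← List.toFinset_card_of_nodup (hL.filter p),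
    ← card_image_of_injective _ hc]
  congr 1
  ext a
  simp only [mem_image, mem_filter_univ, List.mem_toFinset, List.mem_filter, hmem]
  constructor
  · rintro ⟨v, hv, rfl⟩
    exact ⟨⟨v, rfl⟩, hv⟩
  · rintro ⟨⟨v, rfl⟩, hv⟩
    exact ⟨v, hv, rfl⟩

theorem exists_not_adj_of_cliqueLists_eq_nil {G : SimpleGraph V} {r : ℕ → ℕ → Bool} {m : ℕ} {v : V}
    (hc : c.Injective) (hL : L.Nodup) (hmem : ∀ a, a ∈ L ↔ ∃ v, c v = a)
    (hr : ∀ v w, r (c v) (c w) ↔ G.Adj v w)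
    (h : cliqueLists r m (filterRec (r (c v)) L) = []) (s : Finset V) (hs : G.IsNClique m s) :
    ∃ u ∈ s, ¬G.Adj v u := by
  classical
  by_contra! hadj
  let p (a : ℕ) : Bool := a ∈ s.image c
  have hmem_p {a : ℕ} (ha : a ∈ L.filter p) : ∃ u ∈ s, c u = a := by
    simpa [p] using List.of_mem_filter ha
  have hclique : L.filter p ∈ cliqueLists r m (filterRec (r (c v)) L) := by
    refine mem_cliqueLists.2 ⟨?_, ?_, ?_⟩
    · rw [filterRec_eq_filter]
      refine List.monotone_filter_right _ fun a ha => ?_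
      obtain ⟨u, hu, rfl⟩ := mem_image.1 (of_decide_eq_true ha)
      exact (hr v u).2 (hadj u hu)
    · rw [← hs.card_eq, ← card_image_of_injective s hc, ← List.toFinset_card_of_nodup (hL.filter p)]
      congr 1
      ext a
      simp only [List.mem_toFinset, List.mem_filter, p, decide_eq_true_iff]
      refine and_iff_right_of_imp fun ha => (hmem a).2 ?_
      obtain ⟨u, -, hu⟩ := mem_image.1 ha
      exact ⟨u, hu⟩
    · refine (hL.filter p).pairwise_of_forall_ne fun a ha b hb hab => ?_
      obtain ⟨⟨u, hu, rfl⟩, ⟨w, hw, rfl⟩⟩ := hmem_p ha, hmem_p hb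
      exact (hr u w).2 (hs.isClique hu hw (ne_of_apply_ne c hab))
  simp [h] at hclique

end CodedGraphs

section BitCodes

open Finset

variable {α : Type*} (f : α ↪ ℕ)

/-- The natural number whose binary digits `1` are at the places `f z` for `z ∈ s`, so that
unions and intersections of sets become bitwise operations. -/
def bitCode (s : Finset α) : ℕ :=
  ∑ z ∈ s, 2 ^ f z

theorem toFinset_bitIndices_bitCode (s : Finset α) :
    (bitCode f s).bitIndices.toFinset = s.map f := by
  rw [bitCode, ← sum_map s f (2 ^ ·), toFinset_bitIndices_sum_two_pow]

theorem testBit_bitCode (s : Finset α) (i : ℕ) : (bitCode f s).testBit i ↔ i ∈ s.map f := by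
  rw [← toFinset_bitIndices_bitCode, List.mem_toFinset, Nat.mem_bitIndices]

theorem bitCode_injective : (bitCode f).Injective := fun s t h => map_injective f <| by
  rw [← toFinset_bitIndices_bitCode, h, toFinset_bitIndices_bitCode]

theorem bitCode_mod {w : ℕ} (hw : ∀ z, w ∣ f z) {s : Finset α} (hs : #s < 2 ^ w - 1) :
    bitCode f s % (2 ^ w - 1) = #s := by
  have hpow (z : α) : 2 ^ f z ≡ 1 [MOD 2 ^ w - 1] := by
    obtain ⟨m, hm⟩ := hw z
    rw [hm, pow_mul]
    exact (Nat.ModEq.pow m (Nat.modEq_sub Nat.one_le_two_pow)).trans (by rw [one_pow])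
  have hsum : bitCode f s ≡ ∑ _z ∈ s, 1 [MOD 2 ^ w - 1] := Nat.ModEq.sum fun z _ => hpow z
  rw [← card_eq_sum_ones] at hsum
  exact Eq.trans hsum (Nat.mod_eq_of_lt hs)

variable [DecidableEq α]

theorem bitCode_union (s t : Finset α) : bitCode f (s ∪ t) = bitCode f s ||| bitCode f t := by
  refine Nat.eq_of_testBit_eq fun i => Bool.eq_iff_iff.2 ?_
  simp only [Nat.testBit_or, Bool.or_eq_true, testBit_bitCode, map_union, mem_union]

theorem bitCode_inter (s t : Finset α) : bitCode f (s ∩ t) = bitCode f s &&& bitCode f t := by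
  refine Nat.eq_of_testBit_eq fun i => Bool.eq_iff_iff.2 ?_
  simp only [Nat.testBit_and, Bool.and_eq_true, testBit_bitCode, map_inter, mem_inter]

end BitCodes

section Hermitian

open Finset

/-- The exponents `i` modulo `273` such that `ωⁱ ∈ 𝔽₄₀₉₆` has trace `0` over `𝔽₁₆`, where the
generator `ω` of `𝔽₄₀₉₆ˣ` is a root of `X¹² + X⁶ + X⁵ + X³ + 1`: a line of `PG(2, 16)`, described as
a planar difference set. -/
def singerSet : Finset (ZMod 273) :=
  image₂ (fun i a => 2 ^ i * a) (range 12) {1, 91, 117}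

/-- Orthogonality of two points of `PG(2, 16)` for the Hermitian form `Tr(x⁶⁴ y)` on `𝔽₄₀₉₆`. The
points are given by their exponents, that is, as elements of `𝔽₄₀₉₆ˣ / 𝔽₁₆ˣ ≃ ZMod 273`. -/
def Perp (x y : ZMod 273) : Prop :=
  64 * x + y ∈ singerSet

instance : DecidableRel Perp := fun x y => inferInstanceAs (Decidable (64 * x + y ∈ singerSet))

theorem two_mul_mem_singerSet : ∀ {z : ZMod 273}, 2 * z ∈ singerSet ↔ z ∈ singerSet := by
  decide +kernel

theorem two_pow_mul_mem_singerSet (a : ℕ) {z : ZMod 273} :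
    2 ^ a * z ∈ singerSet ↔ z ∈ singerSet := by
  induction a with
  | zero => rw [pow_zero, one_mul]
  | succ a ih => rw [pow_succ', mul_assoc, two_mul_mem_singerSet, ih]

instance : Std.Symm Perp where
  symm x y hxy := by
    have h : 64 * x + y = 2 ^ 6 * (64 * y + x) := by
      have : (4096 : ZMod 273) = 1 := rfl
      linear_combination (-y) * this
    rwa [Perp, h, two_pow_mul_mem_singerSet] at hxy

/-- The semilinear similarity `x ↦ ω^(21 b) x^(2^a)` of the Hermitian form, in terms of
exponents. -/
def affinePerpIso (a b : ℕ) : Perp ≃r Perp where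
  toEquiv := (ZMod.unitOfCoprime (2 ^ a) (Nat.Coprime.pow_left a (by decide))).mulLeft.trans
    (Equiv.addRight (21 * b : ZMod 273))
  map_rel_iff' {x y} := by
    have h : 64 * (2 ^ a * x + 21 * b) + (2 ^ a * y + 21 * b) = 2 ^ a * (64 * x + y) := by
      have : (1365 : ZMod 273) = 0 := rfl
      linear_combination b * this
    simp only [Perp, Equiv.trans_apply, Units.mulLeft_apply, ZMod.coe_unitOfCoprime,
      Nat.cast_pow, Nat.cast_ofNat, Equiv.coe_addRight, h, two_pow_mul_mem_singerSet]

theorem affinePerpIso_apply (a b : ℕ) (x : ZMod 273) :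
    affinePerpIso a b x = 2 ^ a * x + 21 * b := by
  change ((2 ^ a : ℕ) : ZMod 273) * x + 21 * b = _
  rw [Nat.cast_pow, Nat.cast_ofNat]

/-- The orthogonal bases of the Hermitian plane, as triples of projective points: such a point
is isotropic when it is orthogonal to itself. -/
abbrev PolarTriangle : Type :=
  {t : Finset (ZMod 273) // #t = 3 ∧ ∀ x ∈ t, ∀ y ∈ t, Perp x y ↔ x ≠ y}

/-- The isotropic points on the sides of a triangle `t`, the sides being the polars of the
vertices. -/
def isotropicPoints (t : Finset (ZMod 273)) : Finset (ZMod 273) :=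
  {z | Perp z z ∧ ∃ x ∈ t, Perp x z}

/-- The `G₂(4)`-graph on the 416 polar triangles of the Hermitian plane over `𝔽₁₆`. -/
def polarTriangleGraph : SimpleGraph PolarTriangle where
  Adj s t := s ≠ t ∧ #(isotropicPoints s.1 ∩ isotropicPoints t.1) = 3
  symm := ⟨fun s t h => ⟨h.1.symm, by rw [inter_comm, h.2]⟩⟩
  loopless := ⟨fun _ h => h.1 rfl⟩

instance : DecidableRel polarTriangleGraph.Adj := fun s t =>
  inferInstanceAs (Decidable (s ≠ t ∧ #(isotropicPoints s.1 ∩ isotropicPoints t.1) = 3))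

theorem isotropicPoints_map (φ : Perp ≃r Perp) (t : Finset (ZMod 273)) :
    isotropicPoints (t.map φ.toEquiv.toEmbedding) =
      (isotropicPoints t).map φ.toEquiv.toEmbedding := by
  ext z
  obtain ⟨z, rfl⟩ := φ.toEquiv.surjective z
  rw [mem_map_equiv, Equiv.symm_apply_apply]
  simp only [isotropicPoints, mem_filter_univ, mem_map, exists_exists_and_eq_and]
  exact and_congr φ.map_rel_iff
    (exists_congr fun x => and_congr_right fun _ => φ.map_rel_iff)

/-- The graph automorphism induced by an automorphism of the orthogonality relation. -/
def polarTriangleGraphIso (φ : Perp ≃r Perp) : polarTriangleGraph ≃g polarTriangleGraph where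
  toEquiv := φ.toEquiv.finsetCongr.subtypeEquiv fun t => by
    simp only [Equiv.finsetCongr_apply, card_map, forall_mem_map]
    exact and_congr_right fun _ => forall₂_congr fun x _ => forall₂_congr fun y _ =>
      iff_congr φ.map_rel_iff.symm φ.toEquiv.injective.ne_iff.symm
  map_rel_iff' {s t} := by
    have h : #(isotropicPoints (s.1.map φ.toEquiv.toEmbedding) ∩
        isotropicPoints (t.1.map φ.toEquiv.toEmbedding)) =
          #(isotropicPoints s.1 ∩ isotropicPoints t.1) := by
      rw [isotropicPoints_map, isotropicPoints_map, ← map_inter, card_map]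
    exact and_congr (Equiv.injective _).ne_iff (Eq.congr_left h)

end Hermitian

namespace PolarTriangle

section Enumeration

open Finset

/-- The binary digits `1` of the code of a set of points of `PG(2, 16)` are at multiples of `9`,
so that the size of the set is the residue of its code modulo `511 = 2 ^ 9 - 1`. -/
def pointPlace : ZMod 273 ↪ ℕ where
  toFun z := 9 * z.val
  inj' _ _ h := ZMod.val_injective 273 (by simpa using h)

/-- The code of the set of points occurring in a list without repetitions. -/
def listCode (l : List (ZMod 273)) : ℕ :=
  (l.map (2 ^ pointPlace ·)).sum

/-- The singer set as a binary number. -/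
def singerMask : ℕ :=
  bitCode ⟨ZMod.val, ZMod.val_injective 273⟩ singerSet

/-- A Boolean form of `Perp` that only uses the arithmetic of natural numbers, for evaluation in the
kernel. -/
def perpTest (x y : ZMod 273) : Bool :=
  Nat.beq (Nat.mod (Nat.shiftRight singerMask
    (Nat.mod (Nat.add (Nat.mul 64 x.val) y.val) 273)) 2) 1

/-- All points of `PG(2, 16)`, by exponents. -/
def points : List (ZMod 273) :=
  List.finRange 273

/-- The isotropic points of the Hermitian plane. -/
noncomputable def isotropicList : List (ZMod 273) :=
  filterRec (fun x => perpTest x x) points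

/-- The polar triangles, each listed once with its vertices in the order of `points`. -/
noncomputable def triangles : List (List (ZMod 273)) :=
  cliqueLists perpTest 3 (filterRec (fun x => (perpTest x x).not) points)

/-- The code of the set of isotropic points on the polar of `x`. -/
noncomputable def polarCode (x : ZMod 273) : ℕ :=
  listCode (filterRec (perpTest x) isotropicList)

/-- The code of the set of isotropic points on the sides of a triangle. It determines the triangle,
and serves as the name of a vertex of the graph in computations. -/
noncomputable def triangleCode (l : List (ZMod 273)) : ℕ :=
  List.rec 0 (fun x _ c => Nat.lor (polarCode x) c) l

/-- The codes of all polar triangles. -/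
noncomputable def triangleCodes : List ℕ :=
  triangles.map triangleCode

/-- Adjacency in `polarTriangleGraph` of two polar triangles with given codes: whether these have
three binary digits `1` in common. -/
def codeAdj (a b : ℕ) : Bool :=
  Nat.beq (Nat.mod (Nat.land a b) 511) 3

/-- The codes of the polar triangles adjacent to the one with code `a`. -/
noncomputable def neighborCodes (a : ℕ) : List ℕ :=
  filterRec (codeAdj a) triangleCodes

/-- One polar triangle from each orbit of the group of all maps `affinePerpIso a b`. -/
def representatives : List (List (ZMod 273)) :=
  [[0, 1, 64], [1, 53, 118], [1, 73, 225], [5, 17, 209], [5, 135, 187], [9, 165, 204]]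

/-- The codes of the vertex sets of all images of `representatives` under maps `affinePerpIso a b`;
`2` has order `12` and `21` has order `13` modulo `273`. -/
def representativeImageCodes : List ℕ :=
  representatives.flatMap fun l => (List.range 12).flatMap fun a => (List.range 13).map fun b =>
    listCode (l.map fun x => 2 ^ a * x + 21 * b)

theorem perpTest_iff {x y : ZMod 273} : perpTest x y ↔ Perp x y := by
  have hval : (64 * x + y).val = (64 * x.val + y.val) % 273 := by
    simp only [ZMod.val_add, ZMod.val_mul, Nat.mod_add_mod]; rfl
  have htest : perpTest x y ↔ singerMask.testBit (64 * x + y).val := by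
    rw [hval, Nat.testBit_eq_decide_div_mod_eq, ← Nat.shiftRight_eq_div_pow, decide_eq_true_iff]
    exact Nat.beq_eq.to_iff
  rw [htest, singerMask, testBit_bitCode, mem_map, Perp]
  exact ⟨fun ⟨z, hz, h⟩ => ZMod.val_injective 273 h ▸ hz, fun h => ⟨_, h, rfl⟩⟩

theorem nodup_points : points.Nodup :=
  List.nodup_finRange 273

theorem mem_points (x : ZMod 273) : x ∈ points :=
  List.mem_finRange x

theorem listCode_eq {l : List (ZMod 273)} (hl : l.Nodup) :
    listCode l = bitCode pointPlace l.toFinset :=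
  (List.sum_toFinset _ hl).symm

theorem polarCode_eq (x : ZMod 273) :
    polarCode x = bitCode pointPlace (isotropicPoints {x}) := by
  rw [polarCode, isotropicList, filterRec_eq_filter, filterRec_eq_filter,
    listCode_eq ((nodup_points.filter _).filter _)]
  congr 1
  ext z
  simp only [isotropicPoints, List.mem_toFinset, List.mem_filter, mem_points, perpTest_iff,
    true_and, mem_filter_univ, mem_singleton, exists_eq_left]

theorem triangleCode_eq (l : List (ZMod 273)) :
    triangleCode l = bitCode pointPlace (isotropicPoints l.toFinset) := by
  induction l with
  | nil => simp [isotropicPoints, bitCode, triangleCode]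
  | cons x l ih =>
    have hunion : isotropicPoints (x :: l).toFinset =
        isotropicPoints {x} ∪ isotropicPoints l.toFinset := by
      ext z
      simp [isotropicPoints, and_or_left]
    rw [hunion, bitCode_union, ← ih, ← polarCode_eq]
    rfl

theorem mem_triangles {l : List (ZMod 273)} : l ∈ triangles ↔
    l.Sublist points ∧ (∀ x ∈ l, ¬Perp x x) ∧ l.length = 3 ∧ l.Pairwise Perp := by
  have hsub : l.Sublist (points.filter fun x => (perpTest x x).not) ↔
      l.Sublist points ∧ ∀ x ∈ l, ¬Perp x x := by
    have hnot (x : ZMod 273) : (perpTest x x).not ↔ ¬Perp x x := by simp [← perpTest_iff]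
    simp only [← hnot]
    refine ⟨fun h => ⟨h.trans List.filter_sublist, fun x hx => (List.mem_filter.1 (h.subset hx)).2⟩,
      fun ⟨h, h'⟩ => ?_⟩
    rw [← List.filter_eq_self.2 h']
    exact h.filter _
  rw [triangles, mem_cliqueLists, filterRec_eq_filter, hsub, and_assoc]
  simp only [perpTest_iff]

theorem nodup_of_mem_triangles {l : List (ZMod 273)} (hl : l ∈ triangles) : l.Nodup :=
  nodup_points.sublist (mem_triangles.1 hl).1

theorem exists_mem_triangles_iff {t : Finset (ZMod 273)} :
    (∃ l ∈ triangles, l.toFinset = t) ↔ #t = 3 ∧ ∀ x ∈ t, ∀ y ∈ t, Perp x y ↔ x ≠ y := by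
  constructor
  · rintro ⟨l, hl, rfl⟩
    obtain ⟨-, hself, hlen, hpair⟩ := mem_triangles.1 hl
    refine ⟨(List.toFinset_card_of_nodup (nodup_of_mem_triangles hl)).trans hlen, ?_⟩
    simp only [List.mem_toFinset]
    refine fun x hx y hy => ⟨?_, fun hxy => hpair.forall hx hy hxy⟩
    · rintro hxy rfl
      exact hself x hx hxy
  · rintro ⟨hcard, ht⟩
    have hmem {x : ZMod 273} : x ∈ points.filter (· ∈ t) ↔ x ∈ t := by
      simp only [List.mem_filter, mem_points, true_and, decide_eq_true_iff]
    have hnodup : (points.filter (· ∈ t)).Nodup := nodup_points.filter _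
    have htoFinset : (points.filter (· ∈ t)).toFinset = t := by
      ext
      rw [List.mem_toFinset, hmem]
    refine ⟨_, mem_triangles.2 ⟨List.filter_sublist, fun x hx => ?_, ?_, ?_⟩, htoFinset⟩
    · exact fun hxx => (ht x (hmem.1 hx) x (hmem.1 hx)).1 hxx rfl
    · rw [← List.toFinset_card_of_nodup hnodup, htoFinset, hcard]
    · exact hnodup.pairwise_of_forall_ne fun x hx y hy =>
        (ht x (hmem.1 hx) y (hmem.1 hy)).2

end Enumeration

section Certificate

open Finset

set_option maxRecDepth 100000 in
theorem length_triangles : triangles.length = 416 := by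
  decide +kernel

set_option maxRecDepth 100000 in
theorem filterRec_beq_representativeImageCodes_ne_nil :
    ∀ l ∈ triangles, filterRec (Nat.beq (listCode l)) representativeImageCodes ≠ [] := by
  decide +kernel

set_option maxRecDepth 100000 in
theorem cliqueLists_beq_triangleCodes : cliqueLists Nat.beq 2 triangleCodes = [] := by
  decide +kernel

set_option maxRecDepth 100000 in
theorem codeAdj_self_of_mem_triangleCodes : ∀ a ∈ triangleCodes, codeAdj a a = false := by
  decide +kernel

set_option maxRecDepth 100000 in
theorem length_filterRec_neighborCodes : ∀ l ∈ representatives, ∀ a ∈ triangleCodes,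
    (filterRec (codeAdj a) (neighborCodes (triangleCode l))).length =
      if triangleCode l = a then 100 else if codeAdj (triangleCode l) a then 36 else 20 := by
  decide +kernel

set_option maxRecDepth 100000 in
theorem cliqueLists_neighborCodes : ∀ l ∈ representatives,
    cliqueLists codeAdj 5 (neighborCodes (triangleCode l)) = [] := by
  decide +kernel

/-- The code of a vertex of `polarTriangleGraph`: that of its set of isotropic points. -/
def vertexCode (v : PolarTriangle) : ℕ :=
  bitCode pointPlace (isotropicPoints v.1)

/-- The vertices of `polarTriangleGraph` listed in `representatives`. -/
def representativeVertices : Set PolarTriangle :=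
  {v | ∃ l ∈ representatives, l.toFinset = v.1}

theorem triangleCode_eq_vertexCode {l : List (ZMod 273)} {v : PolarTriangle}
    (hv : l.toFinset = v.1) : triangleCode l = vertexCode v := by
  rw [triangleCode_eq, hv, vertexCode]

theorem nodup_triangleCodes : triangleCodes.Nodup :=
  nodup_of_cliqueLists_beq_eq_nil cliqueLists_beq_triangleCodes

theorem mem_triangleCodes {a : ℕ} : a ∈ triangleCodes ↔ ∃ v, vertexCode v = a := by
  simp only [triangleCodes, List.mem_map, triangleCode_eq, vertexCode, Subtype.exists,
    ← exists_mem_triangles_iff, exists_prop]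
  exact ⟨fun ⟨l, hl, h⟩ => ⟨_, ⟨l, hl, rfl⟩, h⟩, fun ⟨_, ⟨l, hl, h⟩, h'⟩ => ⟨l, hl, h ▸ h'⟩⟩

theorem vertexCode_injective : vertexCode.Injective := by
  intro v w h
  obtain ⟨l, hl, hv⟩ := exists_mem_triangles_iff.2 v.2
  obtain ⟨l', hl', hw⟩ := exists_mem_triangles_iff.2 w.2
  have hcode : triangleCode l = triangleCode l' := by
    rw [triangleCode_eq_vertexCode hv, triangleCode_eq_vertexCode hw, h]
  have hll' : l = l' := List.inj_on_of_nodup_map nodup_triangleCodes hl hl' hcode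
  exact Subtype.ext (hv.symm.trans (hll' ▸ hw))

theorem codeAdj_vertexCode {v w : PolarTriangle} :
    codeAdj (vertexCode v) (vertexCode w) ↔ polarTriangleGraph.Adj v w := by
  have hcard (s : Finset (ZMod 273)) : #s < 2 ^ 9 - 1 :=
    (card_le_univ s).trans_lt (by rw [ZMod.card]; decide)
  have hiff : codeAdj (vertexCode v) (vertexCode w) ↔
      #(isotropicPoints v.1 ∩ isotropicPoints w.1) = 3 := by
    rw [← bitCode_mod pointPlace (fun z => Dvd.intro z.val rfl) (hcard _), bitCode_inter]
    exact Nat.beq_eq.to_iff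
  refine hiff.trans ⟨fun h => ⟨?_, h⟩, And.right⟩
  rintro rfl
  have := codeAdj_self_of_mem_triangleCodes _ (mem_triangleCodes.2 ⟨v, rfl⟩)
  rw [hiff.2 h] at this
  exact Bool.noConfusion this

theorem card_eq : Fintype.card PolarTriangle = 416 := by
  have h := card_filter_eq_length_filterRec vertexCode_injective nodup_triangleCodes
    (fun _ => mem_triangleCodes) fun _ => true
  simpa only [filterRec_eq_filter, List.filter_true, filter_true, card_univ, triangleCodes,
    List.length_map, length_triangles] using h

theorem exists_iso_mem_representativeVertices (v : PolarTriangle) :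
    ∃ φ : polarTriangleGraph ≃g polarTriangleGraph, φ v ∈ representativeVertices := by
  obtain ⟨l, hl, hv⟩ := exists_mem_triangles_iff.2 v.2
  obtain ⟨c, hc⟩ := List.exists_mem_of_ne_nil _
    (filterRec_beq_representativeImageCodes_ne_nil l hl)
  rw [filterRec_eq_filter, List.mem_filter, representativeImageCodes] at hc
  simp only [List.mem_flatMap, List.mem_map, ← affinePerpIso_apply] at hc
  obtain ⟨⟨r, hr, a, -, b, -, hrc⟩, hlc⟩ := hc
  have hrnodup : (r.map (affinePerpIso a b)).Nodup :=
    ((show ∀ r ∈ representatives, r.Nodup by decide) r hr).map (affinePerpIso a b).injective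
  have himage : (r.map (affinePerpIso a b)).toFinset = l.toFinset := by
    refine bitCode_injective pointPlace ?_
    rw [← listCode_eq hrnodup, ← listCode_eq (nodup_of_mem_triangles hl),
      Nat.eq_of_beq_eq_true hlc]
    exact hrc
  refine ⟨polarTriangleGraphIso (affinePerpIso a b).symm, r, hr, ?_⟩
  change _ = v.1.map _
  rw [← hv, ← himage]
  ext z
  rw [mem_map_equiv, List.mem_toFinset, List.mem_toFinset]
  exact (List.mem_map_of_injective (affinePerpIso a b).injective).symm

theorem card_commonNeighbors {v : PolarTriangle} {l : List (ZMod 273)}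
    (hl : l ∈ representatives) (hv : l.toFinset = v.1) (w : PolarTriangle) :
    #{u | polarTriangleGraph.Adj v u ∧ polarTriangleGraph.Adj w u} =
      if v = w then 100 else if polarTriangleGraph.Adj v w then 36 else 20 := by
  have hcount := length_filterRec_neighborCodes l hl _ (mem_triangleCodes.2 ⟨w, rfl⟩)
  simp only [neighborCodes, filterRec_eq_filter, List.filter_filter,
    triangleCode_eq_vertexCode hv, codeAdj_vertexCode, vertexCode_injective.eq_iff] at hcount
  rw [← hcount, ← filterRec_eq_filter, ← card_filter_eq_length_filterRec vertexCode_injective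
    nodup_triangleCodes fun _ => mem_triangleCodes]
  simp only [Bool.and_eq_true, codeAdj_vertexCode, and_comm]

theorem isSRGWith_polarTriangleGraph : polarTriangleGraph.IsSRGWith 416 100 36 20 := by
  rw [← card_eq]
  refine isSRGWith_of_representatives exists_iso_mem_representativeVertices ?_
  rintro v ⟨l, hl, hv⟩
  exact card_commonNeighbors hl hv

theorem cliqueFree_polarTriangleGraph : polarTriangleGraph.CliqueFree 6 := by
  refine cliqueFree_succ_of_representatives exists_iso_mem_representativeVertices ?_
  rintro v ⟨l, hl, hv⟩
  exact exists_not_adj_of_cliqueLists_eq_nil vertexCode_injective nodup_triangleCodes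
    (fun _ => mem_triangleCodes) (fun _ _ => codeAdj_vertexCode)
    (triangleCode_eq_vertexCode hv ▸ cliqueLists_neighborCodes l hl)

end Certificate

end PolarTriangle

theorem exists_isPyramidBase_sixtyFive :
    ∃ A : Set (EuclideanSpace ℝ (Fin 65)), IsPyramidBase A 84 := by
  have hne : polarTriangleGraph ≠ ⊤ := by
    intro htop
    obtain ⟨s, -, hs⟩ := Finset.exists_subset_card_eq
      (show 6 ≤ Fintype.card PolarTriangle by rw [PolarTriangle.card_eq]; norm_num)
    have hfree := PolarTriangle.cliqueFree_polarTriangleGraph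
    rw [htop] at hfree
    exact hfree s ⟨fun _ _ _ _ h => h, hs⟩
  exact exists_isPyramidBase_of_isSRGWith (θ := 20) (τ := -4) (m := 5)
    PolarTriangle.isSRGWith_polarTriangleGraph (by norm_num) (by norm_num) (by norm_num)
    (by norm_num) (by norm_num) hne PolarTriangle.cliqueFree_polarTriangleGraph (by omega)

theorem theorem1_general (n : ℕ) (hn : 65 ≤ n) : n + 19 ≤ borsukNumber n := by
  obtain ⟨A, hA⟩ := exists_isPyramidBase_sixtyFive
  obtain ⟨d, rfl⟩ := Nat.exists_eq_add_of_le hn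
  calc 65 + d + 19 = 84 + d := by omega
    _ ≤ borsukNumber (65 + d) := hA.le_borsukNumber d

theorem theorem1 :
    333 ≤ borsukNumber 321 ∧ ∀ n : ℕ, 321 ≤ n → n + 1 < borsukNumber n :=
  ⟨le_trans (by norm_num) (theorem1_general 321 (by norm_num)), fun n hn =>
    lt_of_lt_of_le (by omega) (theorem1_general n (by omega))⟩
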